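/- Let $m,n,l,p,r\ge 0$ be integers and $E,A\in\mathbb{R}^{m\times n}$, $B\in\mathbb{R}^{m\times l}$, $C\in\mathbb{R}^{p\times n}$, $K\in\mathbb{R}^{r\times n}$; no regularity of the pencil $\lambda E-A$ is assumed. Consider the descriptor system $$E\dot x=Ax+Bu,\qquad y=Cx,\qquad z=Kx,\tag{1}$$ whose solutions are the tuples $(x,u,y,z)$ of functions in $L^1_{\mathrm{loc}}$ on $\mathbb{R}$ (with values in $\mathbb{R}^n,\mathbb{R}^l,\mathbb{R}^p,\mathbb{R}^r$) such that $Ex$ is locally absolutely continuous and (1) holds for almost all $t\in\mathbb{R}$, where $E\dot x$ stands for $\frac{d}{dt}(Ex)$. Put $\mathscr{E}=[E\;\;0]$ and $\mathscr{A}=[A\;\;B]$, both in $\mathbb{R}^{m\times(n+l)}$. Let $F\in\mathbb{R}^{nm\times n(n+l)}$ be the block matrix with $n$ block rows and $n$ block columns that has $\mathscr{E}$ in every diagonal block, $\mathscr{A}$ in every block of the first superdiagonal, and zeros elsewhere. Let $\mathcal{A}\in\mathbb{R}^{nm\times n}$ be the matrix with $n$ block rows of which the last is $A$ and the others are $0\in\mathbb{R}^{m\times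 n}$. For $\lambda\in\mathbb{C}$ set $$\Psi=\begin{bmatrix}F&\mathcal{A}&0\\0&E&A\\0&C&0\\0&0&C\\0&0&K\\0&K&0\end{bmatrix},\qquad \Gamma=\begin{bmatrix}F&\mathcal{A}&0\\0&E&A\\0&C&0\\0&0&C\\0&0&K\end{bmatrix},\qquad \Omega(\lambda)=\begin{bmatrix}F&\mathcal{A}&0\\0&E&A\\0&C&0\\0&0&C\\0&K&\lambda K\end{bmatrix}.$$ Assume that (H1) $\operatorname{rank}\Psi=\operatorname{rank}\Gamma$, and (H2) $\operatorname{rank}\Omega(\lambda)=\operatorname{rank}\Gamma$ for every $\lambda\in\mathbb{C}$ with $\operatorname{Re}\lambda\ge 0$. Then there exist an integer $0\le q\le r$ and matrices $N\in\mathbb{R}^{q\times q}$, $H\in\mathbb{R}^{q\times(l+p)}$, $R\in\mathbb{R}^{r\times q}$, $M\in\mathbb{R}^{r\times(l+p)}$ such that the system $$\dot w=Nw+H\begin{bmatrix}u\\y\end{bmatrix},\qquad \hat z=Rw+M\begin{bmatrix}u\\y\end{bmatrix}\tag{2}$$ is a functional ODE observer for (1), that is: for every solution $(x,u,y,z)$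 of (1) there are a locally absolutely continuous $w:\mathbb{R}\to\mathbb{R}^q$ and a function $\hat z\in L^1_{\mathrm{loc}}(\mathbb{R};\mathbb{R}^r)$ that satisfy (2) for almost all $t\in\mathbb{R}$, and all such $w,\hat z$ have the following two properties: (a) $\hat z(t)-z(t)\to 0$ as $t\to\infty$, in the sense that $\lim_{t\to\infty}\operatorname{ess\,sup}_{[t,\infty)}\|\hat z-z\|=0$; (b) $\hat z-z$ coincides almost everywhere with a (unique) continuous function $e:\mathbb{R}\to\mathbb{R}^r$, and if $e(0)=0$ (that is, $\hat z(0)=z(0)$), then $\hat z=z$ almost everywhere. -/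

import Mathlib

open MeasureTheory Filter Topology

namespace Descriptor

section BlockMatrices

variable {R : Type*} [CommRing R] {m n l p r : ℕ}

/-- `[E 0]`, of size `m × (n + l)`. -/
def scrE (E : Matrix (Fin m) (Fin n) R) : Matrix (Fin m) (Fin n ⊕ Fin l) R :=
  Matrix.fromCols E 0

/-- `[A B]`, of size `m × (n + l)`. -/
def scrA (A : Matrix (Fin m) (Fin n) R) (B : Matrix (Fin m) (Fin l) R) :
    Matrix (Fin m) (Fin n ⊕ Fin l) R :=
  Matrix.fromCols A B

/-- The block upper bidiagonal matrix with `n` block rows and `n` block columns, `[E 0]` on the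
diagonal and `[A B]` on the first superdiagonal. -/
def matF (E A : Matrix (Fin m) (Fin n) R) (B : Matrix (Fin m) (Fin l) R) :
    Matrix (Fin n × Fin m) (Fin n × (Fin n ⊕ Fin l)) R :=
  Matrix.of fun i j =>
    if j.1 = i.1 then scrE E i.2 j.2
    else if (j.1 : ℕ) = (i.1 : ℕ) + 1 then scrA A B i.2 j.2
    else 0

/-- `[0; A]`: `n` block rows of `m` rows each, the last one is `A` and the others vanish. -/
def calA (A : Matrix (Fin m) (Fin n) R) : Matrix (Fin n × Fin m) (Fin n) R :=
  Matrix.of fun i j => if (i.1 : ℕ) + 1 = n then A i.2 j else 0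

/-- The block row `[0 X Y]`. -/
def blockRow {k : ℕ} (X Y : Matrix (Fin k) (Fin n) R) :
    Matrix (Fin k) ((Fin n × (Fin n ⊕ Fin l)) ⊕ (Fin n ⊕ Fin n)) R :=
  Matrix.fromCols 0 (Matrix.fromCols X Y)

/-- The block rows common to the three matrices below:
`[F 𝒜 0; 0 E A; 0 C 0; 0 0 C]`. -/
def common (E A : Matrix (Fin m) (Fin n) R) (B : Matrix (Fin m) (Fin l) R)
    (C : Matrix (Fin p) (Fin n) R) :
    Matrix ((((Fin n × Fin m) ⊕ Fin m) ⊕ Fin p) ⊕ Fin p)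
      ((Fin n × (Fin n ⊕ Fin l)) ⊕ (Fin n ⊕ Fin n)) R :=
  Matrix.fromRows
    (Matrix.fromRows
      (Matrix.fromRows
        (Matrix.fromCols (matF E A B) (Matrix.fromCols (calA A) 0))
        (blockRow E A))
      (blockRow C 0))
    (blockRow 0 C)

/-- `Γ = [F 𝒜 0; 0 E A; 0 C 0; 0 0 C; 0 0 K]`. -/
def Gamma (E A : Matrix (Fin m) (Fin n) R) (B : Matrix (Fin m) (Fin l) R)
    (C : Matrix (Fin p) (Fin n) R) (K : Matrix (Fin r) (Fin n) R) :
    Matrix (((((Fin n × Fin m) ⊕ Fin m) ⊕ Fin p) ⊕ Fin p) ⊕ Fin r)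
      ((Fin n × (Fin n ⊕ Fin l)) ⊕ (Fin n ⊕ Fin n)) R :=
  Matrix.fromRows (common E A B C) (blockRow 0 K)

/-- `Ψ = [F 𝒜 0; 0 E A; 0 C 0; 0 0 C; 0 0 K; 0 K 0]`. -/
def Psi (E A : Matrix (Fin m) (Fin n) R) (B : Matrix (Fin m) (Fin l) R)
    (C : Matrix (Fin p) (Fin n) R) (K : Matrix (Fin r) (Fin n) R) :
    Matrix ((((((Fin n × Fin m) ⊕ Fin m) ⊕ Fin p) ⊕ Fin p) ⊕ Fin r) ⊕ Fin r)
      ((Fin n × (Fin n ⊕ Fin l)) ⊕ (Fin n ⊕ Fin n)) R :=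
  Matrix.fromRows (Gamma E A B C K) (blockRow K 0)

/-- `Ω(s) = [F 𝒜 0; 0 E A; 0 C 0; 0 0 C; 0 K sK]`, a complex matrix built from real ones. -/
def Omega (E A : Matrix (Fin m) (Fin n) ℝ) (B : Matrix (Fin m) (Fin l) ℝ)
    (C : Matrix (Fin p) (Fin n) ℝ) (K : Matrix (Fin r) (Fin n) ℝ) (s : ℂ) :
    Matrix (((((Fin n × Fin m) ⊕ Fin m) ⊕ Fin p) ⊕ Fin p) ⊕ Fin r)
      ((Fin n × (Fin n ⊕ Fin l)) ⊕ (Fin n ⊕ Fin n)) ℂ :=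
  Matrix.fromRows
    (common (E.map Complex.ofReal) (A.map Complex.ofReal) (B.map Complex.ofReal)
      (C.map Complex.ofReal))
    (blockRow (K.map Complex.ofReal) (s • K.map Complex.ofReal))

end BlockMatrices

section Behavior

variable {m n l p r q : ℕ}

/-- Locally absolutely continuous functions `ℝ → ℝ^k`. -/
def ACLoc {k : ℕ} (f : ℝ → Fin k → ℝ) : Prop :=
  ∀ a b : ℝ, AbsolutelyContinuousOnInterval f a b

/-- `f(t) → 0` as `t → ∞`, in the sense `lim_{t → ∞} ess sup_{[t, ∞)} ‖f‖ = 0`. -/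
def EssTendstoZero {k : ℕ} (f : ℝ → Fin k → ℝ) : Prop :=
  Tendsto (fun t : ℝ => essSup (fun s => ‖f s‖ₑ) (volume.restrict (Set.Ici t))) atTop (𝓝 0)

/-- The behavior: `(x, u, y, z)` is a solution of `E x' = A x + B u`, `y = C x`, `z = K x`.
As `x` itself need not be differentiable, `E x'` is the derivative of the locally absolutely
continuous function `E x`. -/
structure IsSolution (E A : Matrix (Fin m) (Fin n) ℝ) (B : Matrix (Fin m) (Fin l) ℝ)
    (C : Matrix (Fin p) (Fin n) ℝ) (K : Matrix (Fin r) (Fin n) ℝ)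
    (x : ℝ → Fin n → ℝ) (u : ℝ → Fin l → ℝ) (y : ℝ → Fin p → ℝ) (z : ℝ → Fin r → ℝ) :
    Prop where
  x_loc : LocallyIntegrable x
  u_loc : LocallyIntegrable u
  y_loc : LocallyIntegrable y
  z_loc : LocallyIntegrable z
  ac : ACLoc fun t => E.mulVec (x t)
  dyn : ∀ᵐ t : ℝ, HasDerivAt (fun s => E.mulVec (x s)) (A.mulVec (x t) + B.mulVec (u t)) t
  out : ∀ᵐ t : ℝ, y t = C.mulVec (x t)
  fn : ∀ᵐ t : ℝ, z t = K.mulVec (x t)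

/-- `(w, u, y, zh)` satisfies `w' = N w + H [u; y]`, `zh = R w + M [u; y]` almost everywhere,
with `w` locally absolutely continuous and `zh` locally integrable. -/
structure IsObserverSolution (N : Matrix (Fin q) (Fin q) ℝ)
    (H : Matrix (Fin q) (Fin l ⊕ Fin p) ℝ) (R : Matrix (Fin r) (Fin q) ℝ)
    (M : Matrix (Fin r) (Fin l ⊕ Fin p) ℝ)
    (u : ℝ → Fin l → ℝ) (y : ℝ → Fin p → ℝ) (w : ℝ → Fin q → ℝ) (zh : ℝ → Fin r → ℝ) :
    Prop where
  ac : ACLoc w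
  zh_loc : LocallyIntegrable zh
  dyn : ∀ᵐ t : ℝ, HasDerivAt w (N.mulVec (w t) + H.mulVec (Sum.elim (u t) (y t))) t
  out : ∀ᵐ t : ℝ, zh t = R.mulVec (w t) + M.mulVec (Sum.elim (u t) (y t))

/-- The ODE system with coefficients `N, H, R, M` is a functional ODE observer of the descriptor
system `E, A, B, C, K`. The functions `z` and `zh` are determined only up to null sets, so that
`zh(0) = z(0)` is read through the (unique) continuous representative `e` of the error `zh - z`;
that there is one is part of the requirement. -/
def IsFunctionalObserver (E A : Matrix (Fin m) (Fin n) ℝ) (B : Matrix (Fin m) (Fin l) ℝ)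
    (C : Matrix (Fin p) (Fin n) ℝ) (K : Matrix (Fin r) (Fin n) ℝ)
    (N : Matrix (Fin q) (Fin q) ℝ) (H : Matrix (Fin q) (Fin l ⊕ Fin p) ℝ)
    (R : Matrix (Fin r) (Fin q) ℝ) (M : Matrix (Fin r) (Fin l ⊕ Fin p) ℝ) : Prop :=
  ∀ x u y z, IsSolution E A B C K x u y z →
    (∃ w zh, IsObserverSolution N H R M u y w zh) ∧
    ∀ w zh, IsObserverSolution N H R M u y w zh →
      EssTendstoZero (fun t => zh t - z t) ∧
      ∃ e : ℝ → Fin r → ℝ, Continuous e ∧ (∀ᵐ t : ℝ, zh t - z t = e t) ∧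
        (e 0 = 0 → ∀ᵐ t : ℝ, zh t = z t)

end Behavior

end Descriptor

/-!
Let `M` be the rows common to the three matrices. In terms of kernels, (H1) says that `[0 K 0]`
vanishes on `ker M ⊓ ker [0 0 K]`, so that `[0 0 K] v ↦ -[0 K 0] v` is a well-defined partial linear
map on `ℝ^r`, and (H2) says that it has no eigenvector with eigenvalue in the closed right half
plane. A partial endomorphism can be extended to the whole space without creating eigenvalues other
than a prescribed one, here `-1`. The extension `G` is thus Hurwitz, and
`[0 K 0] + G [0 0 K] = Z M` for some `Z`.

Comparing block columns in this equation, the columns of `F` yield a chain of annihilators of the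
differentiated equations, by which `V (A x + B u) = 0` for the last block `V` of `Z`, and the
remaining columns then give `z = Q E x + (terms in u and y)`, where `Q E x` satisfies an ordinary
differential equation with state matrix `G` and input `(u, y)`. So `z` is itself an output of the
observer with state matrix `G`. Every estimation error is a difference of two outputs for the same
input, hence solves `e' = G e`.
-/

open scoped Matrix

namespace Descriptor

section LinearAlgebra

variable {𝕜 V W X : Type*} [Field 𝕜] [AddCommGroup V] [Module 𝕜 V] [AddCommGroup W] [Module 𝕜 W]
  [AddCommGroup X] [Module 𝕜 X]

theorem exists_comp_eq_of_ker_le {f : V →ₗ[𝕜] W} {g : V →ₗ[𝕜] X}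
    (h : LinearMap.ker f ≤ LinearMap.ker g) : ∃ L : W →ₗ[𝕜] X, L ∘ₗ f = g := by
  obtain ⟨s, hs⟩ := f.rangeRestrict.exists_rightInverse_of_surjective f.range_rangeRestrict
  obtain ⟨L, hL⟩ := (g ∘ₗ s).exists_extend
  refine ⟨L, LinearMap.ext fun v => ?_⟩
  have hLv : L (f v) = g (s (f.rangeRestrict v)) := LinearMap.congr_fun hL (f.rangeRestrict v)
  have hker : s (f.rangeRestrict v) - v ∈ LinearMap.ker f := by
    have := congrArg Subtype.val (LinearMap.congr_fun hs (f.rangeRestrict v))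
    simpa [sub_eq_zero] using this
  have := h hker
  rw [LinearMap.mem_ker, map_sub, sub_eq_zero] at this
  rw [LinearMap.comp_apply, hLv, this]

theorem exists_retraction_comp_eq {D : Submodule 𝕜 X} {f : D →ₗ[𝕜] X} {g : Module.End 𝕜 D}
    (h : ∀ d d' : D, f d = d' → g d = d') :
    ∃ π : X →ₗ[𝕜] D, (∀ d : D, π d = d) ∧ ∀ d, π (f d) = g d := by
  obtain ⟨π, hπ⟩ : ∃ π : X →ₗ[𝕜] D, π ∘ₗ D.subtype.coprod f = LinearMap.id.coprod g := by
    refine exists_comp_eq_of_ker_le fun ⟨d, d'⟩ hd => ?_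
    have hgd : g d' = -d := h d' (-d) (eq_neg_of_add_eq_zero_right hd)
    simp [hgd]
  exact ⟨π, fun d => by simpa using LinearMap.congr_fun hπ (d, 0),
    fun d => by simpa using LinearMap.congr_fun hπ (0, d)⟩

theorem exists_extend_range_le_of_comp_eq [FiniteDimensional 𝕜 X] {D : Submodule 𝕜 X}
    (f : D →ₗ[𝕜] X) (μ : 𝕜) (Y : Type*) [AddCommGroup Y] [Module 𝕜 Y] :
    ∃ g : Module.End 𝕜 X, g ∘ₗ D.subtype = f ∧
      ∀ σ : Module.End 𝕜 Y, Function.Surjective (σ - algebraMap 𝕜 (Module.End 𝕜 Y) μ) →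
        ∀ φ : Y →ₗ[𝕜] X, g ∘ₗ φ = φ ∘ₗ σ → LinearMap.range φ ≤ D := by
  induction hd : Module.finrank 𝕜 X using Nat.strong_induction_on generalizing X with
  | h d ih =>
  obtain rfl | hD := eq_or_ne D ⊤
  · exact ⟨f ∘ₗ Submodule.topEquiv.symm.toLinearMap, rfl, fun _ _ _ _ => le_top⟩
  let f₁ : D.comap f →ₗ[𝕜] D := f.restrict fun _ hx => hx
  obtain ⟨g₁, hg₁, hrange⟩ := ih _ (hd ▸ Submodule.finrank_lt hD) f₁ rfl
  obtain ⟨π, hπD, hπf⟩ : ∃ π : X →ₗ[𝕜] D, (∀ d : D, π d = d) ∧ ∀ d, π (f d) = g₁ d :=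
    exists_retraction_comp_eq fun d d' h =>
      (LinearMap.congr_fun hg₁ ⟨d, by simp [h]⟩).trans (Subtype.ext h)
  -- `π` intertwines this extension with `g₁`, and on `ker π` the extension is the scalar `μ`.
  refine ⟨f ∘ₗ π + μ • (LinearMap.id - D.subtype ∘ₗ π), ?_, fun σ hσ φ hφ => ?_⟩
  · ext d
    simp [hπD]
  have hgφ (y : Y) : f (π (φ y)) + μ • (φ y - π (φ y)) = φ (σ y) := LinearMap.congr_fun hφ y
  have hg₁φ (y : Y) : g₁ (π (φ y)) = π (φ (σ y)) := by simp [← hgφ, hπf, hπD]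
  have hfφ (y : Y) : f (π (φ y)) = π (φ (σ y)) := by
    have hmem : π (φ y) ∈ D.comap f :=
      hrange σ hσ (π ∘ₗ φ) (LinearMap.ext hg₁φ) ⟨y, rfl⟩
    have hf₁ : g₁ (π (φ y)) = f₁ ⟨_, hmem⟩ := LinearMap.congr_fun hg₁ ⟨_, hmem⟩
    rw [← hg₁φ, hf₁]; rfl
  rintro _ ⟨y, rfl⟩
  obtain ⟨y, rfl⟩ := hσ y
  have hfix : φ (σ y - μ • y) = π (φ (σ y - μ • y)) := by
    have hsum := hgφ y
    rw [hfφ] at hsum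
    simp only [map_sub, map_smul, Submodule.coe_sub, Submodule.coe_smul]
    linear_combination (norm := module) -hsum
  exact hfix ▸ (π _).2

theorem exists_comp_eq_add_comp [FiniteDimensional 𝕜 X] {M : V →ₗ[𝕜] W} {a b : V →ₗ[𝕜] X}
    (h : LinearMap.ker M ⊓ LinearMap.ker b ≤ LinearMap.ker a) (μ : 𝕜)
    (Y : Type*) [AddCommGroup Y] [Module 𝕜 Y] :
    ∃ (g : Module.End 𝕜 X) (Z : W →ₗ[𝕜] X), Z ∘ₗ M = a + g ∘ₗ b ∧
      ∀ σ : Module.End 𝕜 Y, Function.Surjective (σ - algebraMap 𝕜 (Module.End 𝕜 Y) μ) →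
        ∀ φ : Y →ₗ[𝕜] X, g ∘ₗ φ = φ ∘ₗ σ →
          ∃ ψ : Y →ₗ[𝕜] V, M ∘ₗ ψ = 0 ∧ b ∘ₗ ψ = φ ∧ a ∘ₗ ψ + φ ∘ₗ σ = 0 := by
  let b₀ := b.domRestrict (LinearMap.ker M)
  obtain ⟨f, hf⟩ : ∃ f : LinearMap.range b₀ →ₗ[𝕜] X,
      f ∘ₗ b₀.rangeRestrict = -a.domRestrict (LinearMap.ker M) := by
    refine exists_comp_eq_of_ker_le fun v hv => ?_
    have hbv : b v = 0 := by simpa [b₀] using hv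
    have hav : a v = 0 := h ⟨v.2, hbv⟩
    simp [hav]
  obtain ⟨g, hgf, hrange⟩ := exists_extend_range_le_of_comp_eq f μ Y
  have hg (v : LinearMap.ker M) : g (b v) = -a v :=
    (LinearMap.congr_fun hgf (b₀.rangeRestrict v)).trans (LinearMap.congr_fun hf v)
  obtain ⟨Z, hZ⟩ : ∃ Z : W →ₗ[𝕜] X, Z ∘ₗ M = a + g ∘ₗ b := by
    refine exists_comp_eq_of_ker_le fun v hv => ?_
    simp [hg ⟨v, hv⟩]
  refine ⟨g, Z, hZ, fun σ hσ φ hφ => ?_⟩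
  obtain ⟨s, hs⟩ := b₀.rangeRestrict.exists_rightInverse_of_surjective b₀.range_rangeRestrict
  let φ₀ := φ.codRestrict (LinearMap.range b₀) fun y => hrange σ hσ φ hφ ⟨y, rfl⟩
  have hb (y : Y) : b (s (φ₀ y)) = φ y := congrArg Subtype.val (LinearMap.congr_fun hs (φ₀ y))
  refine ⟨(LinearMap.ker M).subtype ∘ₗ s ∘ₗ φ₀, ?_, LinearMap.ext hb, LinearMap.ext fun y => ?_⟩
  · ext y
    simp
  · have hgφ : g (φ y) = φ (σ y) := LinearMap.congr_fun hφ y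
    have hga := hg (s (φ₀ y))
    rw [hb, hgφ] at hga
    simp [hga]

end LinearAlgebra

section Rank

variable {ι κ ρ 𝕜 : Type*} [Field 𝕜]

theorem exists_mul_eq_of_ker_le [Fintype ι] [Fintype κ] {M : Matrix ι κ 𝕜} {N : Matrix ρ κ 𝕜}
    (h : LinearMap.ker M.mulVecLin ≤ LinearMap.ker N.mulVecLin) :
    ∃ Y : Matrix ρ ι 𝕜, Y * M = N := by
  classical
  obtain ⟨L, hL⟩ := exists_comp_eq_of_ker_le h
  refine ⟨LinearMap.toMatrix' L, Matrix.toLin'.injective ?_⟩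
  rw [Matrix.toLin'_mul, Matrix.toLin'_toMatrix']
  exact hL

theorem ker_mulVecLin_eq_of_rank_le [Fintype κ] {M : Matrix ι κ 𝕜} {N : Matrix ρ κ 𝕜}
    (h : LinearMap.ker M.mulVecLin ≤ LinearMap.ker N.mulVecLin) (hrank : M.rank ≤ N.rank) :
    LinearMap.ker M.mulVecLin = LinearMap.ker N.mulVecLin := by
  refine Submodule.eq_of_le_of_finrank_le h ?_
  have hM := M.mulVecLin.finrank_range_add_finrank_ker
  have hN := N.mulVecLin.finrank_range_add_finrank_ker
  rw [Matrix.rank, Matrix.rank] at hrank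
  omega

theorem exists_mul_eq_fin_rank [Finite ι] [Fintype κ] (M : Matrix ι κ 𝕜) :
    ∃ (X : Matrix ι (Fin M.rank) 𝕜) (Y : Matrix (Fin M.rank) κ 𝕜), X * Y = M := by
  classical
  cases nonempty_fintype ι
  let b := Module.finBasis 𝕜 (LinearMap.range M.mulVecLin)
  refine ⟨LinearMap.toMatrix b (Pi.basisFun 𝕜 ι) (LinearMap.range M.mulVecLin).subtype,
    LinearMap.toMatrix (Pi.basisFun 𝕜 κ) b M.mulVecLin.rangeRestrict, ?_⟩
  exact (LinearMap.toMatrix_comp _ b _ _ _).symm.trans (LinearMap.toMatrix'_toLin' M)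

theorem rank_map_le [Finite ι] [Fintype κ] {𝕝 : Type*} [Field 𝕝] (M : Matrix ι κ 𝕜)
    (f : 𝕜 →+* 𝕝) :
    (M.map f).rank ≤ M.rank := by
  obtain ⟨X, Y, hXY⟩ := exists_mul_eq_fin_rank M
  calc (M.map f).rank = (X.map f * Y.map f).rank := by rw [← Matrix.map_mul, hXY]
    _ ≤ (X.map f).rank := Matrix.rank_mul_le_left _ _
    _ ≤ M.rank := by simpa using (X.map f).rank_le_card_width

theorem ker_mulVecLin_map_le [Finite ι] [Fintype κ] {𝕝 : Type*} [Field 𝕝] {M : Matrix ι κ 𝕜}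
    {N : Matrix ρ κ 𝕜} (h : LinearMap.ker M.mulVecLin ≤ LinearMap.ker N.mulVecLin) (f : 𝕜 →+* 𝕝) :
    LinearMap.ker (M.map f).mulVecLin ≤ LinearMap.ker (N.map f).mulVecLin := by
  cases nonempty_fintype ι
  obtain ⟨Y, rfl⟩ := exists_mul_eq_of_ker_le h
  intro v hv
  rw [LinearMap.mem_ker, Matrix.mulVecLin_apply] at hv ⊢
  rw [Matrix.map_mul, ← Matrix.mulVec_mulVec, hv, Matrix.mulVec_zero]

theorem fromRows_mulVec_eq_zero_iff [Fintype κ] {M : Matrix ι κ 𝕜} {N : Matrix ρ κ 𝕜}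
    {v : κ → 𝕜} : Matrix.fromRows M N *ᵥ v = 0 ↔ M *ᵥ v = 0 ∧ N *ᵥ v = 0 := by
  rw [Matrix.fromRows_mulVec, ← Sum.elim_zero_zero, Sum.elim_eq_iff]

end Rank

section Stabilization

variable {ι κ ρ : Type*}

/-- A complex vector `v` encoded as the real linear map `w ↦ Re (w v)` on `ℂ`: real matrices act on
it by composition, and multiplying `v` by a scalar becomes composition with multiplication on
`ℂ`. -/
noncomputable def reMul : (κ → ℂ) ≃ₗ[ℝ] (ℂ →ₗ[ℝ] κ → ℝ) where
  toFun v := LinearMap.pi fun k => Complex.reLm ∘ₗ LinearMap.mulRight ℝ (v k)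
  invFun ψ k := ⟨ψ 1 k, -ψ Complex.I k⟩
  map_add' v v' := by
    ext w k
    simp only [LinearMap.pi_apply, LinearMap.add_apply, Pi.add_apply, LinearMap.comp_apply,
      LinearMap.mulRight_apply, mul_add, map_add]
  map_smul' c v := by
    ext w k
    simp only [LinearMap.pi_apply, LinearMap.smul_apply, Pi.smul_apply, LinearMap.comp_apply,
      LinearMap.mulRight_apply, mul_smul_comm, map_smul, RingHom.id_apply]
  left_inv v := by ext; simp
  right_inv ψ := Complex.basisOneI.ext fun i => funext fun k => by fin_cases i <;> simp

theorem reMul_apply (v : κ → ℂ) (w : ℂ) (k : κ) : reMul v w k = (w * v k).re := rfl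

theorem reMul_smul (s : ℂ) (v : κ → ℂ) : reMul (s • v) = reMul v ∘ₗ LinearMap.mulLeft ℝ s := by
  ext w k
  simp only [reMul_apply, LinearMap.comp_apply, LinearMap.mulLeft_apply, Pi.smul_apply,
    smul_eq_mul, mul_assoc, mul_left_comm]

theorem reMul_mulVec [Fintype κ] (M : Matrix ι κ ℝ) (v : κ → ℂ) :
    reMul (M.map Complex.ofReal *ᵥ v) = M.mulVecLin ∘ₗ reMul v := by
  ext w i
  simp only [LinearMap.comp_apply, Matrix.mulVecLin_apply, reMul_apply, Matrix.mulVec, dotProduct,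
    Matrix.map_apply, Finset.mul_sum, mul_left_comm w, Complex.re_sum, Complex.re_ofReal_mul]

/-- All complex eigenvalues of the real matrix `G` lie in the open left half plane. -/
def IsHurwitz [Fintype ι] [DecidableEq ι] (G : Matrix ι ι ℝ) : Prop :=
  ∀ s ∈ spectrum ℂ (G.map Complex.ofReal), s.re < 0

theorem isHurwitz_of_forall_mulVec [Fintype ι] [DecidableEq ι] {G : Matrix ι ι ℝ}
    (h : ∀ s : ℂ, 0 ≤ s.re → ∀ v : ι → ℂ, G.map Complex.ofReal *ᵥ v = s • v → v = 0) :
    IsHurwitz G := by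
  intro s hs
  by_contra! hre
  rw [← Matrix.spectrum_toLin', ← Module.End.hasEigenvalue_iff_mem_spectrum] at hs
  obtain ⟨v, hv⟩ := hs.exists_hasEigenvector
  exact hv.2 (h s hre v hv.apply_eq_smul)

theorem surjective_mulLeft_sub_algebraMap {s : ℂ} {μ : ℝ} (h : s ≠ μ) :
    Function.Surjective (LinearMap.mulLeft ℝ s - algebraMap ℝ (Module.End ℝ ℂ) μ) := by
  refine fun w => ⟨w / (s - μ), ?_⟩
  have := sub_ne_zero.mpr h
  simp only [LinearMap.sub_apply, LinearMap.mulLeft_apply, Module.algebraMap_end_apply,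
    Complex.real_smul]
  field_simp

theorem exists_isHurwitz_mul_eq_of_mulVec [Fintype ι] [Fintype κ] [Fintype ρ] [DecidableEq ρ]
    {M : Matrix ι κ ℝ} {a b : Matrix ρ κ ℝ} (h : ∀ v, M *ᵥ v = 0 → b *ᵥ v = 0 → a *ᵥ v = 0)
    (hs : ∀ s : ℂ, 0 ≤ s.re → ∀ v, M.map Complex.ofReal *ᵥ v = 0 →
      a.map Complex.ofReal *ᵥ v + s • b.map Complex.ofReal *ᵥ v = 0 →
      b.map Complex.ofReal *ᵥ v = 0) :
    ∃ (G : Matrix ρ ρ ℝ) (Z : Matrix ρ ι ℝ), IsHurwitz G ∧ Z * M = a + G * b := by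
  classical
  obtain ⟨g, Z, hZ, hg⟩ := exists_comp_eq_add_comp (M := M.mulVecLin) (a := a.mulVecLin)
    (b := b.mulVecLin) (fun v hv => h v hv.1 hv.2) (-1) ℂ
  refine ⟨LinearMap.toMatrix' g, LinearMap.toMatrix' Z,
    isHurwitz_of_forall_mulVec fun s hre v hv => ?_, Matrix.toLin'.injective ?_⟩
  · have hne : s ≠ (-1 : ℝ) := by
      rintro rfl
      norm_num at hre
    have hgv : g ∘ₗ reMul v = reMul v ∘ₗ LinearMap.mulLeft ℝ s := by
      rw [← reMul_smul, ← hv, reMul_mulVec, ← Matrix.toLin'_apply', Matrix.toLin'_toMatrix']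
    obtain ⟨ψ, hM, hb, ha⟩ := hg _ (surjective_mulLeft_sub_algebraMap hne) _ hgv
    obtain ⟨v', rfl⟩ := reMul.surjective ψ
    rw [← reMul_mulVec, map_eq_zero_iff _ reMul.injective] at hM
    rw [← reMul_mulVec, reMul.injective.eq_iff] at hb
    rw [← reMul_mulVec, ← reMul_smul, ← map_add, map_eq_zero_iff _ reMul.injective, ← hb] at ha
    rw [← hb, hs s hre v' hM ha]
  · rw [Matrix.toLin'_mul, map_add, Matrix.toLin'_mul, Matrix.toLin'_toMatrix',
      Matrix.toLin'_toMatrix']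
    exact hZ

theorem exists_isHurwitz_mul_eq [Fintype ι] [Fintype κ] [Fintype ρ] [DecidableEq ρ]
    {M : Matrix ι κ ℝ} {a b : Matrix ρ κ ℝ}
    (h : (Matrix.fromRows (Matrix.fromRows M b) a).rank = (Matrix.fromRows M b).rank)
    (hs : ∀ s : ℂ, 0 ≤ s.re →
      (Matrix.fromRows (M.map Complex.ofReal)
        (a.map Complex.ofReal + s • b.map Complex.ofReal)).rank = (Matrix.fromRows M b).rank) :
    ∃ (G : Matrix ρ ρ ℝ) (Z : Matrix ρ ι ℝ), IsHurwitz G ∧ Z * M = a + G * b := by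
  have hker : LinearMap.ker (Matrix.fromRows M b).mulVecLin ≤ LinearMap.ker a.mulVecLin := by
    rw [← ker_mulVecLin_eq_of_rank_le (M := Matrix.fromRows (Matrix.fromRows M b) a) _ h.le]
    · exact fun v hv => (fromRows_mulVec_eq_zero_iff.mp hv).2
    · exact fun v hv => (fromRows_mulVec_eq_zero_iff.mp hv).1
  let Mℂ := M.map Complex.ofReal
  let aℂ := a.map Complex.ofReal
  let bℂ := b.map Complex.ofReal
  have hmap : (Matrix.fromRows M b).map Complex.ofReal = Matrix.fromRows Mℂ bℂ := by
    ext (i | i) <;> rfl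
  have hkerℂ (s : ℂ) (hre : 0 ≤ s.re) : LinearMap.ker (Matrix.fromRows Mℂ bℂ).mulVecLin =
      LinearMap.ker (Matrix.fromRows Mℂ (aℂ + s • bℂ)).mulVecLin := by
    refine ker_mulVecLin_eq_of_rank_le (fun v hv => ?_) ?_
    · have ha : aℂ *ᵥ v = 0 := ker_mulVecLin_map_le hker Complex.ofRealHom (hmap ▸ hv)
      obtain ⟨hM, hb⟩ := fromRows_mulVec_eq_zero_iff.mp hv
      refine fromRows_mulVec_eq_zero_iff.mpr ⟨hM, ?_⟩
      rw [Matrix.add_mulVec, Matrix.smul_mulVec, ha, hb, smul_zero, add_zero]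
    · rw [hs s hre, ← hmap]
      exact rank_map_le _ Complex.ofRealHom
  refine exists_isHurwitz_mul_eq_of_mulVec
    (fun v hM hb => hker (fromRows_mulVec_eq_zero_iff.mpr ⟨hM, hb⟩)) fun s hre v hM hab => ?_
  rw [← Matrix.smul_mulVec, ← Matrix.add_mulVec] at hab
  exact (fromRows_mulVec_eq_zero_iff.mp <|
    (hkerℂ s hre).ge (fromRows_mulVec_eq_zero_iff.mpr ⟨hM, hab⟩)).2

end Stabilization

section Exponential

open NormedSpace (exp)

variable {V : Type*} [NormedAddCommGroup V] [NormedSpace ℂ V] [CompleteSpace V] (f : V →L[ℂ] V)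

theorem exp_smul_apply_of_pow_apply_eq_zero {c : ℂ} {k : ℕ} {v : V}
    (hv : ((f - algebraMap ℂ (V →L[ℂ] V) c) ^ k) v = 0) (t : ℝ) :
    exp (t • f) v = ∑ j ∈ Finset.range k,
      (Complex.exp (c * t) * (t : ℂ) ^ j / j.factorial) •
        ((f - algebraMap ℂ (V →L[ℂ] V) c) ^ j) v := by
  set N := f - algebraMap ℂ (V →L[ℂ] V) c with hN
  have hsplit : t • f = algebraMap ℂ (V →L[ℂ] V) (c * t) + (t : ℂ) • N := by
    ext x
    simp [hN, smul_sub]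
  have hseries : HasSum (fun j : ℕ => ((t : ℂ) ^ j / j.factorial) • (N ^ j) v)
      (exp ((t : ℂ) • N) v) := by
    have := (NormedSpace.exp_series_hasSum_exp' (𝕂 := ℂ) ((t : ℂ) • N)).mapL
      (ContinuousLinearMap.apply ℂ V v)
    simpa [smul_pow, mul_smul, div_eq_inv_mul, ← Complex.coe_smul] using this
  have hfinite : exp ((t : ℂ) • N) v =
      ∑ j ∈ Finset.range k, ((t : ℂ) ^ j / j.factorial) • (N ^ j) v := by
    refine hseries.unique (hasSum_sum_of_ne_finset_zero fun j hj => ?_)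
    obtain ⟨i, rfl⟩ := Nat.exists_eq_add_of_le (not_lt.mp (Finset.mem_range.not.mp hj))
    rw [add_comm k, pow_add N, mul_apply_eq_comp, hv, map_zero, smul_zero]
  let _ : NormedAlgebra ℚ (V →L[ℂ] V) := .restrictScalars ℚ ℂ _
  rw [hsplit, NormedSpace.exp_add_of_commute (Algebra.commutes _ _), mul_apply_eq_comp,
    hfinite, ← NormedSpace.algebraMap_exp_comm, ← Complex.exp_eq_exp_ℂ]
  simp only [ContinuousLinearMap.algebraMap_apply, Finset.smul_sum, smul_smul, mul_div_assoc]

theorem tendsto_exp_mul_mul_pow_atTop {c : ℂ} (hc : c.re < 0) (j : ℕ) :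
    Tendsto (fun t : ℝ => Complex.exp (c * t) * (t : ℂ) ^ j) atTop (𝓝 0) := by
  rw [tendsto_zero_iff_norm_tendsto_zero]
  refine (tendsto_rpow_mul_exp_neg_mul_atTop_nhds_zero j (-c.re) (neg_pos.mpr hc)).congr' ?_
  filter_upwards [eventually_ge_atTop 0] with t ht
  simp [Complex.norm_exp, abs_of_nonneg ht, mul_comm]

theorem tendsto_exp_smul_apply_atTop [FiniteDimensional ℂ V]
    (hf : ∀ c, Module.End.HasEigenvalue (f : Module.End ℂ V) c → c.re < 0) (v : V) :
    Tendsto (fun t : ℝ => exp (t • f) v) atTop (𝓝 0) := by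
  have hv : v ∈ ⨆ c, Module.End.maxGenEigenspace (f : Module.End ℂ V) c :=
    Module.End.iSup_maxGenEigenspace_eq_top (f : Module.End ℂ V) ▸ Submodule.mem_top
  induction hv using Submodule.iSup_induction' with
  | zero => simp
  | add v w _ _ hv hw => simpa using hv.add hw
  | mem c v hv =>
    obtain rfl | hv₀ := eq_or_ne v 0
    · simp
    have hc : c.re < 0 := by
      refine hf c (Module.End.HasUnifEigenvalue.lt (k := ⊤) one_pos ?_)
      exact fun hbot => hv₀ ((Submodule.mem_bot ℂ).mp (hbot ▸ hv))
    obtain ⟨k, hk⟩ := (Module.End.mem_maxGenEigenspace _ _ _).mp hv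
    have hk' : ((f - algebraMap ℂ (V →L[ℂ] V) c) ^ k) v = 0 := by
      rw [← hk, ← ContinuousLinearMap.coe_coe, ContinuousLinearMap.toLinearMap_pow]; rfl
    simp only [exp_smul_apply_of_pow_apply_eq_zero f hk']
    rw [← Finset.sum_const_zero (s := Finset.range k)]
    refine tendsto_finsetSum _ fun j _ => ?_
    simpa using ((tendsto_exp_mul_mul_pow_atTop hc j).div_const _).smul_const
      (((f - algebraMap ℂ (V →L[ℂ] V) c) ^ j) v)

theorem eq_exp_smul_apply_of_hasDerivAt {φ : ℝ → V} (hφ : ∀ t, HasDerivAt φ (f (φ t)) t) (t : ℝ) :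
    φ t = exp (t • f) (φ 0) := by
  have hexp (t : ℝ) : HasDerivAt (fun t : ℝ => exp (t • f) (φ 0)) (f (exp (t • f) (φ 0))) t :=
    ((ContinuousLinearMap.apply ℂ V (φ 0)).restrictScalars ℝ).hasFDerivAt.comp_hasDerivAt t
      (hasDerivAt_exp_smul_const' f t)
  refine congrFun (ODE_solution_unique_univ (v := fun _ => f) (s := fun _ => Set.univ) (t₀ := 0)
    (fun _ => f.lipschitz.lipschitzOnWith) (fun t => ⟨hφ t, trivial⟩)
    (fun t => ⟨hexp t, trivial⟩) (by simp)) t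

end Exponential

section Complexification

variable {ι κ : Type*}

theorem hasDerivAt_ofReal_comp [Fintype ι] {G : Matrix ι ι ℝ} {e : ℝ → ι → ℝ} {t : ℝ}
    (he : HasDerivAt e (G *ᵥ e t) t) :
    HasDerivAt (fun s i => (e s i : ℂ)) (G.map Complex.ofReal *ᵥ fun i => (e t i : ℂ)) t := by
  have hmap : (G.map Complex.ofReal *ᵥ fun i => (e t i : ℂ)) = fun i => ((G *ᵥ e t) i : ℂ) :=
    funext fun i => (RingHom.map_mulVec Complex.ofRealHom G (e t) i).symm
  rw [hmap, hasDerivAt_pi]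
  exact fun i => (hasDerivAt_pi.mp he i).ofReal_comp

variable [Fintype ι] {G : Matrix ι ι ℝ} {e : ℝ → ι → ℝ}

theorem ofReal_eq_exp_apply_of_hasDerivAt_mulVec (he : ∀ t, HasDerivAt e (G *ᵥ e t) t) (t : ℝ) :
    (fun i => (e t i : ℂ)) = NormedSpace.exp
      (t • (G.map Complex.ofReal).mulVecLin.toContinuousLinearMap) fun i => (e 0 i : ℂ) :=
  eq_exp_smul_apply_of_hasDerivAt (G.map Complex.ofReal).mulVecLin.toContinuousLinearMap
    (φ := fun s i => (e s i : ℂ)) (fun t => hasDerivAt_ofReal_comp (he t)) t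

theorem IsHurwitz.tendsto_zero [DecidableEq ι] (hG : IsHurwitz G)
    (he : ∀ t, HasDerivAt e (G *ᵥ e t) t) : Tendsto e atTop (𝓝 0) := by
  have hspec (c : ℂ) (hc : Module.End.HasEigenvalue (G.map Complex.ofReal).mulVecLin c) :
      c.re < 0 := by
    refine hG c ?_
    rw [← Matrix.spectrum_toLin', Matrix.toLin'_apply']
    exact hc.mem_spectrum
  have hlim := tendsto_exp_smul_apply_atTop
    (G.map Complex.ofReal).mulVecLin.toContinuousLinearMap hspec fun i => (e 0 i : ℂ)
  simp only [← ofReal_eq_exp_apply_of_hasDerivAt_mulVec he] at hlim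
  rw [tendsto_pi_nhds] at hlim ⊢
  exact fun i => by
    simpa [Function.comp_def] using (Complex.continuous_re.tendsto _).comp (hlim i)

theorem eq_zero_of_hasDerivAt_mulVec (he : ∀ t, HasDerivAt e (G *ᵥ e t) t) (h₀ : e 0 = 0) :
    e = 0 := by
  ext t i
  have := congrFun (ofReal_eq_exp_apply_of_hasDerivAt_mulVec he t) i
  simpa [h₀, ← Pi.zero_def] using this

end Complexification

section Behavior

variable {m n l p r q k : ℕ}

theorem hasDerivAt_mulVec (Q : Matrix (Fin k) (Fin q) ℝ) {f : ℝ → Fin q → ℝ} {f' : Fin q → ℝ}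
    {t : ℝ} (hf : HasDerivAt f f' t) : HasDerivAt (fun s => Q *ᵥ f s) (Q *ᵥ f') t :=
  Q.mulVecLin.toContinuousLinearMap.hasFDerivAt.comp_hasDerivAt t hf

theorem ACLoc.continuous {f : ℝ → Fin k → ℝ} (hf : ACLoc f) : Continuous f := by
  refine continuous_iff_continuousAt.mpr fun t => ?_
  refine (hf (t - 1) (t + 1)).continuousOn.continuousAt ?_
  rw [Set.uIcc_of_le (by linarith)]
  exact Icc_mem_nhds (by linarith) (by linarith)

theorem ACLoc.sub {f g : ℝ → Fin k → ℝ} (hf : ACLoc f) (hg : ACLoc g) : ACLoc (f - g) :=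
  fun a b => (hf a b).sub (hg a b)

theorem ACLoc.mulVec {f : ℝ → Fin q → ℝ} (hf : ACLoc f) (Q : Matrix (Fin k) (Fin q) ℝ) :
    ACLoc fun t => Q *ᵥ f t := by
  intro a b
  let L := Q.mulVecLin.toContinuousLinearMap
  have hL (v w : Fin q → ℝ) : dist (Q *ᵥ v) (Q *ᵥ w) ≤ ‖L‖ * dist v w :=
    L.lipschitz.dist_le_mul v w
  have hlim : Tendsto _ _ _ := hf a b
  refine squeeze_zero (fun _ => Finset.sum_nonneg fun _ _ => dist_nonneg) (fun _ => ?_)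
    (by simpa using hlim.const_mul ‖L‖)
  rw [Finset.mul_sum]
  exact Finset.sum_le_sum fun _ _ => hL _ _

theorem ACLoc.hasDerivAt_of_ae {f v : ℝ → Fin k → ℝ} (hf : ACLoc f) (hv : Continuous v)
    (h : ∀ᵐ t, HasDerivAt f (v t) t) (t : ℝ) : HasDerivAt f (v t) t := by
  let I : ℝ → Fin k → ℝ := fun t => ∫ s in (0 : ℝ)..t, v s
  have hI (t : ℝ) : HasDerivAt I (v t) t := (hv.integral_hasStrictDerivAt 0 t).hasDerivAt
  have hI₁ : ContDiff ℝ 1 I := by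
    rw [contDiff_one_iff_deriv, funext fun t => (hI t).deriv]
    exact ⟨fun t => (hI t).differentiableAt, hv⟩
  obtain ⟨c, hc⟩ := ((hf (t - 1) (t + 1)).sub
    hI₁.contDiffOn.absolutelyContinuousOnInterval).const_of_ae_hasDerivAt_zero (by
      filter_upwards [h] with s hs _
      simpa using hs.sub (hI s))
  refine ((hI t).add_const c).congr_of_eventuallyEq ?_
  filter_upwards [Icc_mem_nhds (sub_one_lt t) (lt_add_one t)] with s hs
  have hcs : f s - I s = c := hc s (by rwa [Set.uIcc_of_le (by linarith)])
  rw [← hcs, add_sub_cancel]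

theorem essTendstoZero_of_ae_eq {f e : ℝ → Fin k → ℝ} (h : ∀ᵐ t, f t = e t)
    (he : Tendsto e atTop (𝓝 0)) : EssTendstoZero f := by
  have he' : Tendsto (fun s => ‖e s‖ₑ) atTop (𝓝 0) := by
    simpa only [enorm_zero] using he.enorm
  rw [EssTendstoZero, ENNReal.tendsto_nhds_zero]
  intro ε hε
  obtain ⟨T, hT⟩ := eventually_atTop.mp (ENNReal.tendsto_nhds_zero.mp he' ε hε)
  filter_upwards [eventually_ge_atTop T] with t ht
  refine essSup_le_of_ae_le _ ?_
  filter_upwards [ae_restrict_of_ae h, ae_restrict_mem measurableSet_Ici] with s hs hst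
  rw [hs]
  exact hT s (ht.trans hst)

variable {u : ℝ → Fin l → ℝ} {y : ℝ → Fin p → ℝ}

section Observer

variable {N : Matrix (Fin q) (Fin q) ℝ} {H : Matrix (Fin q) (Fin l ⊕ Fin p) ℝ}
  {R : Matrix (Fin r) (Fin q) ℝ} {M : Matrix (Fin r) (Fin l ⊕ Fin p) ℝ}
  {w₁ w₂ : ℝ → Fin q → ℝ} {z₁ z₂ : ℝ → Fin r → ℝ}

theorem IsObserverSolution.hasDerivAt_sub (h₁ : IsObserverSolution N H R M u y w₁ z₁)
    (h₂ : IsObserverSolution N H R M u y w₂ z₂) (t : ℝ) :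
    HasDerivAt (w₁ - w₂) (N *ᵥ (w₁ - w₂) t) t := by
  have hac := h₁.ac.sub h₂.ac
  refine hac.hasDerivAt_of_ae (hac.mulVec N).continuous ?_ t
  filter_upwards [h₁.dyn, h₂.dyn] with t ht₁ ht₂
  have hsub : N *ᵥ (w₁ - w₂) t = N *ᵥ w₁ t + H *ᵥ Sum.elim (u t) (y t) -
      (N *ᵥ w₂ t + H *ᵥ Sum.elim (u t) (y t)) := by
    rw [Pi.sub_apply, Matrix.mulVec_sub, add_sub_add_right_eq_sub]
  exact hsub ▸ ht₁.sub ht₂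

theorem IsObserverSolution.ae_sub_eq (h₁ : IsObserverSolution N H R M u y w₁ z₁)
    (h₂ : IsObserverSolution N H R M u y w₂ z₂) : ∀ᵐ t, z₁ t - z₂ t = R *ᵥ (w₁ - w₂) t := by
  filter_upwards [h₁.out, h₂.out] with t ht₁ ht₂
  rw [ht₁, ht₂, add_sub_add_right_eq_sub, Pi.sub_apply, Matrix.mulVec_sub]

theorem isFunctionalObserver_of_forall_exists_isObserverSolution {E A : Matrix (Fin m) (Fin n) ℝ}
    {B : Matrix (Fin m) (Fin l) ℝ} {C : Matrix (Fin p) (Fin n) ℝ} {K : Matrix (Fin r) (Fin n) ℝ}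
    (hN : IsHurwitz N) (hR : Function.Injective R.mulVec)
    (h : ∀ x u y z, IsSolution E A B C K x u y z → ∃ w, IsObserverSolution N H R M u y w z) :
    IsFunctionalObserver E A B C K N H R M := by
  intro x u y z hsol
  obtain ⟨w₀, h₀⟩ := h x u y z hsol
  refine ⟨⟨w₀, z, h₀⟩, fun w zh hw => ?_⟩
  have hderiv := hw.hasDerivAt_sub h₀
  have herr := hw.ae_sub_eq h₀
  have hcont : Continuous fun v => R *ᵥ v := continuous_const.matrix_mulVec continuous_id
  have hlim : Tendsto (fun t => R *ᵥ (w - w₀) t) atTop (𝓝 0) := by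
    simpa only [Matrix.mulVec_zero, Function.comp_def] using
      (hcont.tendsto 0).comp (hN.tendsto_zero hderiv)
  refine ⟨essTendstoZero_of_ae_eq herr hlim, fun t => R *ᵥ (w - w₀) t,
    hcont.comp (hw.ac.sub h₀.ac).continuous, herr, fun he₀ => ?_⟩
  have hzero : w - w₀ = 0 :=
    eq_zero_of_hasDerivAt_mulVec hderiv (hR (he₀.trans (Matrix.mulVec_zero R).symm))
  filter_upwards [herr] with t ht
  rwa [hzero, Pi.zero_apply, Matrix.mulVec_zero, sub_eq_zero] at ht

end Observer

section Solution

variable {E A : Matrix (Fin m) (Fin n) ℝ} {B : Matrix (Fin m) (Fin l) ℝ}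
  {C : Matrix (Fin p) (Fin n) ℝ} {K : Matrix (Fin r) (Fin n) ℝ}
  {x : ℝ → Fin n → ℝ} {z : ℝ → Fin r → ℝ}

theorem IsSolution.ae_mulVec_eq_zero (h : IsSolution E A B C K x u y z)
    {P : Matrix (Fin k) (Fin m) ℝ} (hP : ∀ t, P *ᵥ (E *ᵥ x t) = 0) :
    ∀ᵐ t, P *ᵥ (A *ᵥ x t + B *ᵥ u t) = 0 := by
  filter_upwards [h.dyn] with t ht
  refine (hasDerivAt_mulVec P ht).unique ?_
  simpa only [hP] using hasDerivAt_const t 0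

theorem IsSolution.mulVec_eq_zero_of_chain (h : IsSolution E A B C K x u y z)
    {P : ℕ → Matrix (Fin k) (Fin m) ℝ} {j : ℕ} (h₀ : P 0 = 0)
    (hP : ∀ i < j, P (i + 1) * scrE E + P i * scrA A B = 0) (t : ℝ) :
    P j *ᵥ (E *ᵥ x t) = 0 := by
  induction j generalizing t with
  | zero => rw [h₀, Matrix.zero_mulVec]
  | succ j ih =>
    refine congrFun ((Continuous.ae_eq_iff_eq volume (h.ac.mulVec _).continuous
      continuous_const).mp ?_) t
    filter_upwards [h.ae_mulVec_eq_zero (ih fun i hi => hP i (hi.trans j.lt_succ_self))] with t ht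
    have := congrArg (· *ᵥ Sum.elim (x t) (u t)) (hP j j.lt_succ_self)
    simpa only [scrE, scrA, Matrix.add_mulVec, ← Matrix.mulVec_mulVec,
      Matrix.fromCols_mulVec_sumElim, Matrix.zero_mulVec, add_zero, ht] using this

variable {G : Matrix (Fin r) (Fin r) ℝ} {V Q : Matrix (Fin r) (Fin m) ℝ}
  {S T : Matrix (Fin r) (Fin p) ℝ}

theorem IsSolution.isObserverSolution (h : IsSolution E A B C K x u y z)
    (hV : ∀ᵐ t, V *ᵥ (A *ᵥ x t + B *ᵥ u t) = 0) (hK : V * A + Q * E + S * C = K)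
    (hG : Q * A + T * C = G * K) :
    IsObserverSolution G
      (G * Matrix.fromCols (-(V * B)) S + Matrix.fromCols (Q * B) (-T)) 1
      (Matrix.fromCols (-(V * B)) S) u y (fun t => Q *ᵥ (E *ᵥ x t)) z := by
  set M := Matrix.fromCols (-(V * B)) S with hM
  have hz : ∀ᵐ t, z t = Q *ᵥ (E *ᵥ x t) + M *ᵥ Sum.elim (u t) (y t) := by
    filter_upwards [h.fn, h.out, hV] with t hzt hyt hVt
    rw [Matrix.mulVec_add] at hVt
    rw [hzt, hyt, ← hK, hM, Matrix.fromCols_mulVec_sumElim]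
    simp only [Matrix.add_mulVec, Matrix.neg_mulVec, ← Matrix.mulVec_mulVec,
      eq_neg_of_add_eq_zero_left hVt]
    abel
  refine ⟨h.ac.mulVec Q, h.z_loc, ?_, by simpa only [Matrix.one_mulVec] using hz⟩
  filter_upwards [h.dyn, h.fn, h.out, hz] with t ht hfn hyt hzt
  have hGz : G *ᵥ (Q *ᵥ (E *ᵥ x t)) + G *ᵥ (M *ᵥ Sum.elim (u t) (y t)) =
      Q *ᵥ (A *ᵥ x t) + T *ᵥ y t := by
    rw [← Matrix.mulVec_add, ← hzt, hfn, Matrix.mulVec_mulVec, ← hG, hyt]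
    simp only [Matrix.add_mulVec, ← Matrix.mulVec_mulVec]
  convert! hasDerivAt_mulVec Q ht using 1
  rw [Matrix.add_mulVec, ← Matrix.mulVec_mulVec, ← add_assoc, hGz, Matrix.fromCols_mulVec_sumElim,
    Matrix.mulVec_add, Matrix.neg_mulVec, ← Matrix.mulVec_mulVec]
  abel

theorem exists_isFunctionalObserver_of_chain (hstable : IsHurwitz G)
    {P : ℕ → Matrix (Fin r) (Fin m) ℝ} {j : ℕ} (h₀ : P 0 = 0)
    (hP : ∀ i < j, P (i + 1) * scrE E + P i * scrA A B = 0)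
    (hK : P j * A + Q * E + S * C = K) (hG : Q * A + T * C = G * K) :
    ∃ H M, IsFunctionalObserver E A B C K G H 1 M :=
  ⟨_, _, isFunctionalObserver_of_forall_exists_isObserverSolution hstable
    (fun v w h => by simpa only [Matrix.one_mulVec] using h) fun _ _ _ _ h =>
      ⟨_, h.isObserverSolution (h.ae_mulVec_eq_zero (h.mulVec_eq_zero_of_chain h₀ hP)) hK hG⟩⟩

end Solution

end Behavior

section BlockRows

variable {R : Type*} [CommRing R] {m n l p r k : ℕ}

/-- The `i`-th of the `n` block columns of `Z`, counted from `1`; it is `0` for `i = 0` and for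
`n < i`. -/
def blockCol (Z : Matrix (Fin k) (Fin n × Fin m) R) (i : ℕ) : Matrix (Fin k) (Fin m) R :=
  Matrix.of fun a c => ∑ j : Fin n, if (j : ℕ) + 1 = i then Z a (j, c) else 0

theorem blockCol_zero (Z : Matrix (Fin k) (Fin n × Fin m) R) : blockCol Z 0 = 0 := by
  ext
  simp [blockCol]

theorem blockCol_mul_apply {κ : Type*} (Z : Matrix (Fin k) (Fin n × Fin m) R) (i : ℕ)
    (X : Matrix (Fin m) κ R) (a : Fin k) (b : κ) :
    (blockCol Z i * X) a b =
      ∑ j : Fin n × Fin m, Z a j * if (j.1 : ℕ) + 1 = i then X j.2 b else 0 := by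
  rw [Fintype.sum_prod_type, Finset.sum_comm]
  simp only [Matrix.mul_apply, blockCol, Matrix.of_apply, Finset.sum_mul, ite_mul, zero_mul,
    mul_ite, mul_zero]

theorem mul_calA (Z : Matrix (Fin k) (Fin n × Fin m) R) (A : Matrix (Fin m) (Fin n) R) :
    Z * calA A = blockCol Z n * A := by
  ext a b
  rw [blockCol_mul_apply]
  rfl

theorem mul_matF_apply (Z : Matrix (Fin k) (Fin n × Fin m) R) (E A : Matrix (Fin m) (Fin n) R)
    (B : Matrix (Fin m) (Fin l) R) (a : Fin k) (i : Fin n) (b : Fin n ⊕ Fin l) :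
    (Z * matF E A B) a (i, b) =
      (blockCol Z (i + 1) * scrE E + blockCol Z i * scrA A B :
        Matrix (Fin k) (Fin n ⊕ Fin l) R) a b := by
  rw [Matrix.add_apply, blockCol_mul_apply, blockCol_mul_apply, Matrix.mul_apply,
    ← Finset.sum_add_distrib]
  refine Finset.sum_congr rfl fun j _ => ?_
  rw [← mul_add]
  congr 1
  simp only [matF, Matrix.of_apply, add_left_inj, Fin.ext_iff]
  split_ifs <;> first | omega | simp

theorem blockRow_add_mul_blockRow (G : Matrix (Fin k) (Fin r) R) (X Y : Matrix (Fin k) (Fin n) R)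
    (X' Y' : Matrix (Fin r) (Fin n) R) :
    (blockRow X Y + G * blockRow X' Y' : Matrix _ ((Fin n × (Fin n ⊕ Fin l)) ⊕ _) R) =
      blockRow (X + G * X') (Y + G * Y') := by
  ext i (j | j | j) <;> simp [blockRow, Matrix.mul_fromCols]

theorem fromCols_mul_common (Z : Matrix (Fin k) (Fin n × Fin m) R) (Q : Matrix (Fin k) (Fin m) R)
    (S T : Matrix (Fin k) (Fin p) R) (E A : Matrix (Fin m) (Fin n) R)
    (B : Matrix (Fin m) (Fin l) R) (C : Matrix (Fin p) (Fin n) R) :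
    Matrix.fromCols (Matrix.fromCols (Matrix.fromCols Z Q) S) T * common E A B C =
      Matrix.fromCols (Z * matF E A B)
        (Matrix.fromCols (Z * calA A + Q * E + S * C) (Q * A + T * C)) := by
  ext i (j | j | j) <;>
    simp [common, blockRow, Matrix.fromCols_mul_fromRows, Matrix.fromCols_mul_fromBlocks,
      Matrix.mul_fromCols]

theorem exists_chain_of_mul_common_eq {E A : Matrix (Fin m) (Fin n) R}
    {B : Matrix (Fin m) (Fin l) R} {C : Matrix (Fin p) (Fin n) R} {X Y : Matrix (Fin k) (Fin n) R}
    {Z : Matrix (Fin k) ((((Fin n × Fin m) ⊕ Fin m) ⊕ Fin p) ⊕ Fin p) R}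
    (hZ : Z * common E A B C = blockRow X Y) :
    ∃ (P : ℕ → Matrix (Fin k) (Fin m) R) (Q : Matrix (Fin k) (Fin m) R)
      (S T : Matrix (Fin k) (Fin p) R), P 0 = 0 ∧
      (∀ i < n, P (i + 1) * scrE E + P i * scrA A B = 0) ∧
      P n * A + Q * E + S * C = X ∧ Q * A + T * C = Y := by
  rw [← Matrix.fromCols_toCols Z, ← Matrix.fromCols_toCols Z.toCols₁,
    ← Matrix.fromCols_toCols Z.toCols₁.toCols₁, fromCols_mul_common, blockRow,
    Matrix.fromCols_ext_iff, Matrix.fromCols_ext_iff, mul_calA] at hZ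
  obtain ⟨hF, hX, hY⟩ := hZ
  refine ⟨blockCol Z.toCols₁.toCols₁.toCols₁, _, _, _, blockCol_zero _, fun i hi => ?_, hX, hY⟩
  ext a b
  rw [← mul_matF_apply _ E A B a ⟨i, hi⟩ b, hF]
  rfl

theorem common_map_ofReal (E A : Matrix (Fin m) (Fin n) ℝ) (B : Matrix (Fin m) (Fin l) ℝ)
    (C : Matrix (Fin p) (Fin n) ℝ) :
    common (E.map Complex.ofReal) (A.map Complex.ofReal) (B.map Complex.ofReal)
      (C.map Complex.ofReal) = (common E A B C).map Complex.ofReal := by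
  ext (((⟨i, i'⟩ | i) | i) | i) (⟨j, j' | j'⟩ | (j | j)) <;>
    simp [common, blockRow, matF, calA, scrE, scrA, apply_ite Complex.ofReal]

theorem Omega_eq (E A : Matrix (Fin m) (Fin n) ℝ) (B : Matrix (Fin m) (Fin l) ℝ)
    (C : Matrix (Fin p) (Fin n) ℝ) (K : Matrix (Fin r) (Fin n) ℝ) (s : ℂ) :
    Omega E A B C K s = Matrix.fromRows ((common E A B C).map Complex.ofReal)
      ((blockRow K 0).map Complex.ofReal + s • (blockRow 0 K).map Complex.ofReal) := by
  rw [Omega, common_map_ofReal]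
  congr 1
  ext i (⟨j, j' | j'⟩ | (j | j)) <;> simp [blockRow]

end BlockRows

end Descriptor

theorem theorem1 {m n l p r : ℕ}
    (E A : Matrix (Fin m) (Fin n) ℝ) (B : Matrix (Fin m) (Fin l) ℝ)
    (C : Matrix (Fin p) (Fin n) ℝ) (K : Matrix (Fin r) (Fin n) ℝ)
    (H1 : (Descriptor.Psi E A B C K).rank = (Descriptor.Gamma E A B C K).rank)
    (H2 : ∀ s : ℂ, 0 ≤ s.re →
      (Descriptor.Omega E A B C K s).rank = (Descriptor.Gamma E A B C K).rank) :
    ∃ q : ℕ, q ≤ r ∧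
      ∃ (N : Matrix (Fin q) (Fin q) ℝ) (H : Matrix (Fin q) (Fin l ⊕ Fin p) ℝ)
        (R : Matrix (Fin r) (Fin q) ℝ) (M : Matrix (Fin r) (Fin l ⊕ Fin p) ℝ),
        Descriptor.IsFunctionalObserver E A B C K N H R M := by
  simp only [Descriptor.Omega_eq] at H2
  obtain ⟨G, Z, hstable, hZ⟩ := Descriptor.exists_isHurwitz_mul_eq H1 H2
  rw [Descriptor.blockRow_add_mul_blockRow, Matrix.mul_zero, add_zero, zero_add] at hZ
  obtain ⟨P, Q, S, T, h₀, hP, hK, hG⟩ := Descriptor.exists_chain_of_mul_common_eq hZ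
  obtain ⟨H, M, hobs⟩ := Descriptor.exists_isFunctionalObserver_of_chain hstable h₀ hP hK hG
  exact ⟨r, le_rfl, G, H, 1, M, hobs⟩
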